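/- Let $0<\alpha<1/4$. There is an integer $T$, depending only on $\alpha$, such that the following holds. Let $0<c<1$ and let $(a_t)_{t\ge 1}$ be integers with $c\,t^{\alpha}\le a_t\le t^{\alpha}$ for all integers $t\ge 1$. Put $$f_t(X)=X^3+a_t^2(a_t^3-2)X^2-a_t(a_t^3-1)X+1+tX(a_tX-1)\in\mathbf Z[X].$$ Then for every integer $t\ge T$ the polynomial $f_t$ is irreducible over $\mathbf Q$ and all its complex roots are real, it has a smallest positive root $\theta_t^{(1)}$, and $(\theta_t^{(1)},\,a_t\theta_t^{(1)}-1)$ is a system of fundamental units of the order $\mathcal O_t=\mathbf Z[\theta_t^{(1)}]$ of the totally real cubic field $\mathbf Q(\theta_t^{(1)})$; that is, both numbers are units of $\mathcal O_t$ and their classes are $\mathbf Z$-independent generators of $\mathcal O_t^{\times}$ modulo its torsion subgroup. -/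

import Mathlib

open Polynomial

noncomputable section

namespace CubicOrders

/-- The cubic `f_{a,1,t}(X) = X³ + a²(a³ - 2)X² - a(a³ - 1)X + 1 + tX(aX - 1)`. -/
def cubic (a t : ℤ) : ℤ[X] :=
  X ^ 3 + C (a ^ 2 * (a ^ 3 - 2)) * X ^ 2 - C (a * (a ^ 3 - 1)) * X + 1
    + C t * X * (C a * X - 1)

/-- `θ` is the smallest positive real root of `f_{a,1,t}`. -/
def IsSmallestPosRoot (a t : ℤ) (θ : ℝ) : Prop :=
  IsLeast {x : ℝ | 0 < x ∧ aeval x (cubic a t) = 0} θ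

/-- The class of a unit of `O` in `O ˣ` modulo torsion, written additively. -/
def unitClass {O : Type*} [CommRing O] (u : Oˣ) : Additive (Oˣ ⧸ CommGroup.torsion Oˣ) :=
  Additive.ofMul (QuotientGroup.mk u)

/-- `(x, y)` is a system of fundamental units of the ring `O` of real numbers: `x` and `y` are
units of `O` whose classes are `ℤ`-independent generators of the unit group modulo torsion. -/
def IsFundamentalUnits (O : Subring ℝ) (x y : ℝ) : Prop :=
  ∃ u v : Oˣ, ((u : O) : ℝ) = x ∧ ((v : O) : ℝ) = y ∧
    LinearIndependent ℤ ![unitClass u, unitClass v] ∧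
    Submodule.span ℤ {unitClass u, unitClass v} = ⊤

end CubicOrders

end

/-!
Write `S = a⁴ - a + t`, so that the cubic is `X³ - a²X² + SX(aX - 1) + 1`, and
`L = log S`, `A = log a`. The hypothesis `a ≤ t ^ α` with `α < 1/4` enters only through
`2²³ a⁴ ≤ S`, which holds as soon as `t` is large in terms of `α`.

The sign changes of the cubic give three real roots `r₁ ≈ 1/S`, `r₂ ≈ 1/a`, `r₃ ≈ -aS`
(`exists_roots`), and no root is `±1`, so the cubic is irreducible. Both `θ = r₁` and
`η = aθ - 1` are units, as `(aθ - 1)(Sθ - 1 - aθ) = -θ³`. Up to a bounded error, their logarithmic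
vectors over the three real embeddings are `(-L, -A, L + A)` and `(0, -(L + 2A), L + 2A)`.

That they generate all units modulo `±1` is shown directly, using neither Dirichlet's unit theorem
nor regulators. The logarithmic vector of a unit is a real combination of those of `θ` and `η`;
dividing by suitable powers of `θ` and `η` makes both coefficients at most `1/2` in absolute value
(`exists_reduced`). The logarithms of the conjugates of the reduced unit `ε` then differ pairwise by
at most `B = 3L/2 + 3A + 4 log 2`, and as their product is `±1`, this bounds the product of the
differences of the conjugates by `8 exp B` (`mul_add_le_of_ratio_le`). On the other hand, if `ε` is
not rational, that product is the index of `ℤ[ε]` in `ℤ[θ]`, a positive integer, times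
`|(r₁ - r₂)(r₁ - r₃)(r₂ - r₃)| > aS²/16` (`eq_zero_of_disc_large`, `disc_bound`). The two bounds
contradict each other precisely because `L > 4A + 22 log 2`. So `ε` is a rational unit, that
is `±1`.
-/

namespace CubicOrders

/-! ### Conjugates of elements of a cubic order -/

/-- The norm of `p + q * r₁ + r * r₁²`, for `r₁` a root of a monic integer cubic with coefficients
`b`, `c`, `d`, is an integer: it is an integer polynomial in `p`, `q`, `r`, `b`, `c`, `d`. -/
theorem exists_int_norm_eq {r₁ r₂ r₃ : ℝ} {b c d : ℤ} (hb : r₁ + r₂ + r₃ = -b)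
    (hc : r₁ * r₂ + r₁ * r₃ + r₂ * r₃ = c) (hd : r₁ * r₂ * r₃ = -d) (p q r : ℤ) :
    ∃ n : ℤ, (p + q * r₁ + r * r₁ ^ 2) * (p + q * r₂ + r * r₂ ^ 2) *
      (p + q * r₃ + r * r₃ ^ 2) = (n : ℝ) := by
  refine ⟨p ^ 3 + p ^ 2 * q * (-b) + p ^ 2 * r * (b ^ 2 - 2 * c) + p * q ^ 2 * c +
    p * q * r * (-b * c + 3 * d) + p * r ^ 2 * (c ^ 2 - 2 * b * d) + q ^ 3 * (-d) +
    q ^ 2 * r * (b * d) + q * r ^ 2 * (-c * d) + r ^ 3 * d ^ 2, ?_⟩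
  have hb' : (b : ℝ) = -(r₁ + r₂ + r₃) := by linarith
  have hd' : (d : ℝ) = -(r₁ * r₂ * r₃) := by linarith
  push_cast
  rw [← hc, hb', hd']
  ring

/-- Each of the six monomials `x²y` in the expansion of the product equals `x / z ≤ E`, since
`x * y * z = 1`; the remaining term is `2 * x * y * z = 2 ≤ 2 * E`. -/
theorem mul_add_le_of_ratio_le {x y z E : ℝ} (hx : 0 < x) (hy : 0 < y) (hz : 0 < z)
    (h : x * y * z = 1) (hxy : x ≤ E * y) (hyx : y ≤ E * x) (hxz : x ≤ E * z)
    (hzx : z ≤ E * x) (hyz : y ≤ E * z) (hzy : z ≤ E * y) :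
    (x + y) * (x + z) * (y + z) ≤ 8 * E := by
  have key : ∀ u v w : ℝ, 0 < u → 0 < v → u * v * w = 1 → u ≤ E * w → u * u * v ≤ E := by
    intro u v w hu hv huvw huw
    calc u * u * v = u * (u * v) := by ring
      _ ≤ E * w * (u * v) := by gcongr
      _ = E * (u * v * w) := by ring
      _ = E := by rw [huvw, mul_one]
  have hE : 1 ≤ E := by
    by_contra! hE
    nlinarith
  have h1 := key x y z hx hy h hxz
  have h2 := key y x z hy hx (by linarith) hyz
  have h3 := key x z y hx hz (by linarith) hxy
  have h4 := key z x y hz hx (by linarith) hzy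
  have h5 := key y z x hy hz (by linarith) hyx
  have h6 := key z y x hz hy (by linarith) hzx
  linarith

/-- An element `p + q * r₁ + r * r₁²` of norm `±1`, whose conjugates have pairwise ratios at most `E`
in absolute value, is rational when the product of root differences exceeds `8 * E`. -/
theorem eq_zero_of_disc_large {r₁ r₂ r₃ : ℝ} {b c d : ℤ} (hb : r₁ + r₂ + r₃ = -b)
    (hc : r₁ * r₂ + r₁ * r₃ + r₂ * r₃ = c) (hd : r₁ * r₂ * r₃ = -d)
    (h₁ : Irrational r₁) (h₂ : Irrational r₂) (h₃ : Irrational r₃) {p q r : ℤ}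
    {e₁ e₂ e₃ E : ℝ} (he₁ : e₁ = p + q * r₁ + r * r₁ ^ 2) (he₂ : e₂ = p + q * r₂ + r * r₂ ^ 2)
    (he₃ : e₃ = p + q * r₃ + r * r₃ ^ 2) (hN : |e₁| * |e₂| * |e₃| = 1)
    (h12 : |e₁| ≤ E * |e₂|) (h21 : |e₂| ≤ E * |e₁|) (h13 : |e₁| ≤ E * |e₃|)
    (h31 : |e₃| ≤ E * |e₁|) (h23 : |e₂| ≤ E * |e₃|) (h32 : |e₃| ≤ E * |e₂|)
    (hD : 8 * E < |(r₁ - r₂) * (r₁ - r₃) * (r₂ - r₃)|) : q = 0 ∧ r = 0 := by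
  by_contra hqr
  have irr : ∀ x : ℝ, Irrational x → ((q - r * b : ℤ) : ℝ) + ((-r : ℤ) : ℝ) * x
      + ((0 : ℤ) : ℝ) * x ^ 2 ≠ 0 := by
    intro x hx h0
    have hr : r = 0 := by
      by_contra hr
      have hr' : (r : ℝ) ≠ 0 := by exact_mod_cast hr
      refine hx ⟨((q - r * b : ℤ) : ℚ) / r, ?_⟩
      push_cast at h0 ⊢
      rw [div_eq_iff hr']
      linarith
    refine hqr ⟨?_, hr⟩
    subst hr
    simpa using h0
  -- the index of `ℤ[e₁]` in `ℤ[r₁]` is the norm of `q - r * b - r * r₁`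
  obtain ⟨n, hn⟩ := exists_int_norm_eq hb hc hd (q - r * b) (-r) 0
  have hn0 : n ≠ 0 := by
    rintro rfl
    exact mul_ne_zero (mul_ne_zero (irr _ h₁) (irr _ h₂)) (irr _ h₃) (hn.trans Int.cast_zero)
  have hn1 : (1 : ℝ) ≤ |(n : ℝ)| := by exact_mod_cast Int.one_le_abs hn0
  have hdisc : (e₁ - e₂) * (e₁ - e₃) * (e₂ - e₃) =
      (r₁ - r₂) * (r₁ - r₃) * (r₂ - r₃) * n := by
    have hb' : (b : ℝ) = -(r₁ + r₂ + r₃) := by linarith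
    rw [← hn, he₁, he₂, he₃]
    push_cast
    rw [hb']
    ring
  have hpos : 0 < |e₁| ∧ 0 < |e₂| ∧ 0 < |e₃| := by
    refine ⟨?_, ?_, ?_⟩ <;>
    · refine (abs_nonneg _).lt_of_ne' fun h0 => ?_
      simp [h0] at hN
  have hle : |(e₁ - e₂) * (e₁ - e₃) * (e₂ - e₃)| ≤ 8 * E := by
    rw [abs_mul, abs_mul]
    refine le_trans ?_ (mul_add_le_of_ratio_le hpos.1 hpos.2.1 hpos.2.2 hN h12 h21 h13 h31 h23 h32)
    gcongr <;> exact abs_sub _ _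
  rw [hdisc, abs_mul] at hle
  have := mul_le_mul_of_nonneg_left hn1 (abs_nonneg ((r₁ - r₂) * (r₁ - r₃) * (r₂ - r₃)))
  linarith

/-! ### Real embeddings of a monogenic order -/

theorem aeval_eq_zero_of_irreducible {f : ℤ[X]} (hf : f.Monic)
    (hirr : Irreducible (f.map (Int.castRingHom ℚ))) {θ ρ : ℝ} (hθ : aeval θ f = 0)
    (hρ : aeval ρ f = 0) {p : ℤ[X]} (hp : aeval θ p = 0) : aeval ρ p = 0 := by
  have hmap : ∀ (x : ℝ) (g : ℤ[X]), aeval x (g.map (Int.castRingHom ℚ)) = aeval x g :=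
    fun x g => aeval_map_algebraMap ℚ x g
  have hmin : f.map (Int.castRingHom ℚ) = minpoly ℚ θ :=
    minpoly.eq_of_irreducible_of_monic hirr (by rw [hmap, hθ]) (hf.map _)
  obtain ⟨g, hg⟩ := hmin ▸ minpoly.dvd ℚ θ ((hmap θ p).trans hp)
  rw [← hmap, hg, map_mul, hmap, hρ, zero_mul]

theorem irrational_of_irreducible {f : ℤ[X]} (hf : f.Monic) (hdeg : f.natDegree = 3)
    (hirr : Irreducible (f.map (Int.castRingHom ℚ))) {x : ℝ} (hx : aeval x f = 0) :
    Irrational x := by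
  rintro ⟨y, rfl⟩
  have hroot : (f.map (Int.castRingHom ℚ)).IsRoot y := by
    rw [IsRoot, eval_map, ← algebraMap_int_eq, ← aeval_def]
    have : aeval (algebraMap ℚ ℝ y) f = 0 := hx
    rw [aeval_algebraMap_apply] at this
    exact (map_eq_zero _).mp this
  have h1 := degree_eq_one_of_irreducible_of_root hirr hroot
  rw [degree_eq_natDegree hirr.ne_zero, hf.natDegree_map, hdeg] at h1
  norm_num at h1

/-- The embedding of `ℤ[θ]` into `ℝ` sending `θ` to any real root `ρ` of its minimal
polynomial. -/
theorem exists_conj {f : ℤ[X]} (hf : f.Monic)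
    (hirr : Irreducible (f.map (Int.castRingHom ℚ))) {θ ρ : ℝ} (hθ : aeval θ f = 0)
    (hρ : aeval ρ f = 0) :
    ∃ σ : (Algebra.adjoin ℤ {θ}).toSubring →+* ℝ,
      ∀ (x : (Algebra.adjoin ℤ {θ}).toSubring) (p : ℤ[X]), (x : ℝ) = aeval θ p →
        σ x = aeval ρ p := by
  have hex : ∀ x : (Algebra.adjoin ℤ {θ}).toSubring, ∃ p : ℤ[X], aeval θ p = (x : ℝ) := by
    rintro ⟨x, hx⟩
    exact Algebra.adjoin_mem_exists_aeval ℤ θ hx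
  have hwd : ∀ p q : ℤ[X], aeval θ p = aeval θ q → aeval ρ p = aeval ρ q := by
    intro p q hpq
    have := aeval_eq_zero_of_irreducible hf hirr hθ hρ (p := p - q) (by simp [hpq])
    simpa [sub_eq_zero] using this
  choose P hP using hex
  refine ⟨{ toFun := fun x => aeval ρ (P x)
            map_one' := ?_, map_mul' := ?_, map_zero' := ?_, map_add' := ?_ }, ?_⟩
  · rw [hwd _ 1 (by rw [hP]; simp)]; simp
  · intro x y
    rw [← map_mul]; exact hwd _ _ (by rw [map_mul, hP, hP, hP]; rfl)
  · change aeval ρ (P 0) = 0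
    rw [hwd _ 0 (by rw [hP]; simp)]; simp
  · intro x y
    change aeval ρ (P (x + y)) = aeval ρ (P x) + aeval ρ (P y)
    rw [← map_add]; exact hwd _ _ (by rw [map_add, hP, hP, hP]; rfl)
  · intro x p hx
    exact hwd _ _ (by rw [hP, hx])

theorem exists_int_coords {f : ℤ[X]} (hf : f.Monic) (hdeg : f.natDegree = 3) {θ : ℝ}
    (hθ : aeval θ f = 0) {x : ℝ} (hx : x ∈ Algebra.adjoin ℤ {θ}) :
    ∃ p q r : ℤ, x = aeval θ (C p + C q * X + C r * X ^ 2 : ℤ[X]) := by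
  obtain ⟨g, rfl⟩ := Algebra.adjoin_mem_exists_aeval ℤ θ hx
  refine ⟨(g %ₘ f).coeff 0, (g %ₘ f).coeff 1, (g %ₘ f).coeff 2, ?_⟩
  have hlt : (g %ₘ f).natDegree < 3 := by
    rw [← hdeg]
    exact natDegree_modByMonic_lt g hf (by rintro rfl; simp at hdeg)
  have : g %ₘ f = C ((g %ₘ f).coeff 0) + C ((g %ₘ f).coeff 1) * X
      + C ((g %ₘ f).coeff 2) * X ^ 2 := by
    conv_lhs => rw [as_sum_range_C_mul_X_pow' _ hlt]
    simp [Finset.sum_range_succ]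
  rw [← this, ← aeval_modByMonic_eq_self_of_root hθ]

/-! ### Logarithmic embeddings of units -/

/-- The map `u ↦ log |σ u|` on the unit group of a ring with a homomorphism `σ` to `ℝ`, as a
homomorphism from the unit group written additively. -/
noncomputable def logAbs {R : Type*} [CommRing R] (σ : R →+* ℝ) : Additive Rˣ →+ ℝ where
  toFun u := Real.log |σ (u.toMul : Rˣ)|
  map_zero' := by simp
  map_add' u v := by
    have h : ∀ w : Rˣ, |σ w| ≠ 0 := fun w =>
      abs_ne_zero.mpr ((w.isUnit.map σ).ne_zero)
    simp only [toMul_add, Units.val_mul, map_mul, abs_mul]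
    exact Real.log_mul (h _) (h _)

theorem logAbs_ofMul {R : Type*} [CommRing R] (σ : R →+* ℝ) (u : Rˣ) :
    logAbs σ (Additive.ofMul u) = Real.log |σ u| := rfl

theorem abs_norm_unit_eq_one {O : Type*} [CommRing O] {σ₁ σ₂ σ₃ : O →+* ℝ} {r₁ r₂ r₃ : ℝ}
    {b c d : ℤ} (hb : r₁ + r₂ + r₃ = -b)
    (hc : r₁ * r₂ + r₁ * r₃ + r₂ * r₃ = c) (hd : r₁ * r₂ * r₃ = -d)
    (hσ : ∀ x, ∃ p q r : ℤ, σ₁ x = p + q * r₁ + r * r₁ ^ 2 ∧ σ₂ x = p + q * r₂ + r * r₂ ^ 2 ∧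
      σ₃ x = p + q * r₃ + r * r₃ ^ 2) (u : Oˣ) : |σ₁ u| * |σ₂ u| * |σ₃ u| = 1 := by
  have hint : ∀ x, ∃ n : ℤ, σ₁ x * σ₂ x * σ₃ x = n := by
    intro x
    obtain ⟨p, q, r, h1, h2, h3⟩ := hσ x
    rw [h1, h2, h3]
    exact exists_int_norm_eq hb hc hd p q r
  obtain ⟨m, hm⟩ := hint u
  obtain ⟨n, hn⟩ := hint (u⁻¹ : Oˣ)
  have hmn : m * n = 1 := by
    have hinv : ∀ σ : O →+* ℝ, σ u * σ (u⁻¹ : Oˣ) = 1 := fun σ => by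
      rw [← map_mul, Units.mul_inv, map_one]
    have : (m : ℝ) * n = 1 := by
      rw [← hm, ← hn]
      calc _ = (σ₁ u * σ₁ (u⁻¹ : Oˣ)) * (σ₂ u * σ₂ (u⁻¹ : Oˣ)) * (σ₃ u * σ₃ (u⁻¹ : Oˣ)) := by ring
        _ = 1 := by simp only [hinv, mul_one]
    exact_mod_cast this
  rw [← abs_mul, ← abs_mul, hm]
  exact_mod_cast Int.isUnit_iff_abs_eq.mp (IsUnit.of_mul_eq_one n hmn)

/-- A unit whose conjugates are too close in absolute value, compared with the discriminant of the
order, is `±1`. -/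
theorem unit_eq_one_or_neg_one {O : Type*} [CommRing O] {σ₁ σ₂ σ₃ : O →+* ℝ}
    (hinj : Function.Injective σ₁) {r₁ r₂ r₃ : ℝ} {b c d : ℤ} (hb : r₁ + r₂ + r₃ = -b)
    (hc : r₁ * r₂ + r₁ * r₃ + r₂ * r₃ = c) (hd : r₁ * r₂ * r₃ = -d)
    (h₁ : Irrational r₁) (h₂ : Irrational r₂) (h₃ : Irrational r₃)
    (hσ : ∀ x, ∃ p q r : ℤ, σ₁ x = p + q * r₁ + r * r₁ ^ 2 ∧ σ₂ x = p + q * r₂ + r * r₂ ^ 2 ∧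
      σ₃ x = p + q * r₃ + r * r₃ ^ 2) {B : ℝ}
    (hD : 8 * Real.exp B < |(r₁ - r₂) * (r₁ - r₃) * (r₂ - r₃)|) (u : Oˣ)
    (h12 : |logAbs σ₁ (.ofMul u) - logAbs σ₂ (.ofMul u)| ≤ B)
    (h13 : |logAbs σ₁ (.ofMul u) - logAbs σ₃ (.ofMul u)| ≤ B)
    (h23 : |logAbs σ₂ (.ofMul u) - logAbs σ₃ (.ofMul u)| ≤ B) : u = 1 ∨ u = -1 := by
  have hpos : ∀ σ : O →+* ℝ, 0 < |σ u| := fun σ =>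
    abs_pos.mpr ((u.isUnit.map σ).ne_zero)
  have ratio : ∀ σ τ : O →+* ℝ, |logAbs σ (.ofMul u) - logAbs τ (.ofMul u)| ≤ B →
      |σ u| ≤ Real.exp B * |τ u| ∧ |τ u| ≤ Real.exp B * |σ u| := by
    have main : ∀ σ τ : O →+* ℝ, logAbs σ (.ofMul u) - logAbs τ (.ofMul u) ≤ B →
        |σ u| ≤ Real.exp B * |τ u| := by
      intro σ τ h
      rw [logAbs_ofMul, logAbs_ofMul, sub_le_iff_le_add] at h
      have := Real.exp_le_exp.mpr h
      rwa [Real.exp_add, Real.exp_log (hpos _), Real.exp_log (hpos _)] at this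
    intro σ τ h
    exact ⟨main σ τ (le_of_abs_le h), main τ σ (by linarith [neg_le_of_abs_le h])⟩
  have hN := abs_norm_unit_eq_one hb hc hd hσ u
  obtain ⟨p, q, r, e1, e2, e3⟩ := hσ u
  obtain ⟨rfl, rfl⟩ := eq_zero_of_disc_large hb hc hd h₁ h₂ h₃ e1 e2 e3 hN
    (ratio _ _ h12).1 (ratio _ _ h12).2 (ratio _ _ h13).1 (ratio _ _ h13).2
    (ratio _ _ h23).1 (ratio _ _ h23).2 hD
  simp only [Int.cast_zero, zero_mul, add_zero] at e1 e2 e3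
  rw [e1, e2, e3] at hN
  have hp : |p| = 1 := by
    have : |(p : ℝ)| ^ 3 = 1 := by rw [← hN]; ring
    have := (pow_eq_one_iff_of_nonneg (abs_nonneg _) (by norm_num)).mp this
    exact_mod_cast this
  rcases (abs_eq zero_le_one).mp hp with rfl | rfl
  · left; ext; apply hinj; simp [e1]
  · right; ext; apply hinj; simp [e1]

/-! ### Reduction modulo a lattice of units -/

theorem abs_mul_add_mul_le {x y p q P Q : ℝ} (hx : |x| ≤ 1 / 2) (hy : |y| ≤ 1 / 2) (hp : |p| ≤ P)
    (hq : |q| ≤ Q) : |x * p + y * q| ≤ (P + Q) / 2 := by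
  refine (abs_add_le _ _).trans ?_
  rw [abs_mul, abs_mul]
  have h1 := mul_le_mul hx hp (abs_nonneg _) (by norm_num)
  have h2 := mul_le_mul hy hq (abs_nonneg _) (by norm_num)
  linarith

/-- Reduction of `w` modulo the lattice spanned by `u` and `v`: a translate of `w` has coordinates
`x`, `y` with respect to `u`, `v` of absolute value at most `1 / 2`. -/
theorem exists_reduced {A : Type*} [AddCommGroup A] (l₁ l₂ l₃ : A →+ ℝ)
    (hsum : ∀ w, l₁ w + l₂ w + l₃ w = 0) (u v : A) (hdet : l₁ u * l₂ v - l₂ u * l₁ v ≠ 0) (w : A) :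
    ∃ (i j : ℤ) (x y : ℝ), |x| ≤ 1 / 2 ∧ |y| ≤ 1 / 2 ∧
      l₁ (w - i • u - j • v) = x * l₁ u + y * l₁ v ∧
      l₂ (w - i • u - j • v) = x * l₂ u + y * l₂ v ∧
      l₃ (w - i • u - j • v) = x * l₃ u + y * l₃ v := by
  set Δ := l₁ u * l₂ v - l₂ u * l₁ v with hΔ
  -- Cramer's rule
  set x := (l₁ w * l₂ v - l₂ w * l₁ v) / Δ with hx
  set y := (l₁ u * l₂ w - l₂ u * l₁ w) / Δ with hy
  have e1 : l₁ w = x * l₁ u + y * l₁ v := by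
    rw [hx, hy]; field_simp; rw [hΔ]; ring
  have e2 : l₂ w = x * l₂ u + y * l₂ v := by
    rw [hx, hy]; field_simp; rw [hΔ]; ring
  refine ⟨round x, round y, x - round x, y - round y, abs_sub_round x, abs_sub_round y, ?_, ?_, ?_⟩
  · simp only [map_sub, map_zsmul, zsmul_eq_mul]; linarith
  · simp only [map_sub, map_zsmul, zsmul_eq_mul]; linarith
  · -- the third coordinate is determined by the other two
    have h0 := hsum w
    have h1 := hsum u
    have h2 := hsum v
    simp only [map_sub, map_zsmul, zsmul_eq_mul]
    have : l₃ w = x * l₃ u + y * l₃ v := by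
      linear_combination h0 - x * h1 - y * h2 - e1 - e2
    linarith

/-- Two units with independent logarithmic vectors are fundamental if every unit whose logarithms
over the three embeddings differ pairwise by at most `B` is `±1`. The bound `2 * B` for `u` and `v`
together gives `B` for reduced units, whose coordinates are at most `1 / 2`. -/
theorem isFundamentalUnits_of_reduction {O : Subring ℝ} (l₁ l₂ l₃ : Additive Oˣ →+ ℝ)
    (hsum : ∀ w, l₁ w + l₂ w + l₃ w = 0) (u v : Oˣ)
    (hdet : l₁ (.ofMul u) * l₂ (.ofMul v) - l₂ (.ofMul u) * l₁ (.ofMul v) ≠ 0)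
    (B : ℝ)
    (h12 : |l₁ (.ofMul u) - l₂ (.ofMul u)| + |l₁ (.ofMul v) - l₂ (.ofMul v)| ≤ 2 * B)
    (h13 : |l₁ (.ofMul u) - l₃ (.ofMul u)| + |l₁ (.ofMul v) - l₃ (.ofMul v)| ≤ 2 * B)
    (h23 : |l₂ (.ofMul u) - l₃ (.ofMul u)| + |l₂ (.ofMul v) - l₃ (.ofMul v)| ≤ 2 * B)
    (htors : ∀ w : Oˣ, |l₁ (.ofMul w) - l₂ (.ofMul w)| ≤ B → |l₁ (.ofMul w) - l₃ (.ofMul w)| ≤ B →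
      |l₂ (.ofMul w) - l₃ (.ofMul w)| ≤ B → w = 1 ∨ w = -1) :
    IsFundamentalUnits O (u : O) (v : O) := by
  refine ⟨u, v, rfl, rfl, ?_, ?_⟩
  · rw [LinearIndependent.pair_iff]
    intro i j hij
    have hmem : u ^ i * v ^ j ∈ CommGroup.torsion Oˣ := by
      rw [← QuotientGroup.eq_one_iff]
      exact Additive.ofMul.injective hij
    obtain ⟨n, hn, hn1⟩ := isOfFinOrder_iff_pow_eq_one.mp hmem
    have hz : ∀ l : Additive Oˣ →+ ℝ, i * l (.ofMul u) + j * l (.ofMul v) = 0 := by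
      intro l
      have := congrArg (fun z => l (.ofMul z)) hn1
      simp only [ofMul_pow, ofMul_mul, ofMul_zpow, ofMul_one, map_nsmul, map_add, map_zsmul,
        map_zero, nsmul_eq_mul, zsmul_eq_mul, mul_eq_zero, Nat.cast_eq_zero, hn.ne', false_or]
        at this
      exact this
    have z1 := hz l₁
    have z2 := hz l₂
    constructor
    · have : (i : ℝ) * (l₁ (.ofMul u) * l₂ (.ofMul v) - l₂ (.ofMul u) * l₁ (.ofMul v)) = 0 := by
        linear_combination l₂ (.ofMul v) * z1 - l₁ (.ofMul v) * z2
      exact_mod_cast (mul_eq_zero.mp this).resolve_right hdet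
    · have : (j : ℝ) * (l₁ (.ofMul u) * l₂ (.ofMul v) - l₂ (.ofMul u) * l₁ (.ofMul v)) = 0 := by
        linear_combination l₁ (.ofMul u) * z2 - l₂ (.ofMul u) * z1
      exact_mod_cast (mul_eq_zero.mp this).resolve_right hdet
  · rw [eq_top_iff]
    rintro z -
    obtain ⟨w, rfl⟩ : ∃ w, unitClass w = z := by
      obtain ⟨w, hw⟩ := QuotientGroup.mk_surjective z.toMul
      exact ⟨w, congrArg Additive.ofMul hw⟩
    obtain ⟨i, j, x, y, hx, hy, e1, e2, e3⟩ :=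
      exists_reduced l₁ l₂ l₃ hsum (.ofMul u) (.ofMul v) hdet (.ofMul w)
    rw [Submodule.mem_span_pair]
    refine ⟨i, j, ?_⟩
    set s : Oˣ := w / u ^ i / v ^ j with hs
    have hs' : Additive.ofMul s =
        Additive.ofMul w - i • Additive.ofMul u - j • Additive.ofMul v := by
      rw [hs]; simp
    have close : ∀ k l : Additive Oˣ →+ ℝ, k (.ofMul s) = x * k (.ofMul u) + y * k (.ofMul v) →
        l (.ofMul s) = x * l (.ofMul u) + y * l (.ofMul v) →
        |k (.ofMul u) - l (.ofMul u)| + |k (.ofMul v) - l (.ofMul v)| ≤ 2 * B →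
        |k (.ofMul s) - l (.ofMul s)| ≤ B := by
      intro k l hk hl hB
      have := abs_mul_add_mul_le hx hy (le_refl |k (.ofMul u) - l (.ofMul u)|)
        (le_refl |k (.ofMul v) - l (.ofMul v)|)
      rw [hk, hl]
      calc _ = |x * (k (.ofMul u) - l (.ofMul u)) + y * (k (.ofMul v) - l (.ofMul v))| := by
            congr 1; ring
        _ ≤ B := by linarith
    rw [← hs'] at e1 e2 e3
    have hsmem : s ∈ CommGroup.torsion Oˣ := by
      rcases htors s (close _ _ e1 e2 h12) (close _ _ e1 e3 h13) (close _ _ e2 e3 h23) with h | h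
      · rw [h]; exact one_mem _
      · rw [h]; exact isOfFinOrder_iff_pow_eq_one.mpr ⟨2, by norm_num, by simp⟩
    have hw : w = u ^ i * v ^ j * s := by
      rw [hs, mul_comm, div_div, div_mul_cancel]
    have : (QuotientGroup.mk w : Oˣ ⧸ CommGroup.torsion Oˣ) = QuotientGroup.mk (u ^ i * v ^ j) := by
      rw [hw, QuotientGroup.mk_mul, (QuotientGroup.eq_one_iff s).mpr hsmem, mul_one]
    exact (congrArg Additive.ofMul this).symm

/-! ### The cubic and its irreducibility -/

theorem aeval_cubic (a t : ℤ) (x : ℝ) : aeval x (cubic a t) =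
    x ^ 3 - a ^ 2 * x ^ 2 + (a ^ 4 - a + t : ℝ) * x * (a * x - 1) + 1 := by
  simp only [cubic, map_add, map_sub, map_mul, map_pow, aeval_X, aeval_C, map_one]
  simp
  ring

theorem cubic_eq (a t : ℤ) : cubic a t = X ^ 3 + C (a * (a ^ 4 - a + t) - a ^ 2) * X ^ 2
    + C (-(a ^ 4 - a + t)) * X + C 1 := by
  simp only [cubic, map_add, map_sub, map_mul, map_pow, map_neg, map_one, map_ofNat]
  ring

theorem natDegree_cubic (a t : ℤ) : (cubic a t).natDegree = 3 := by
  rw [cubic_eq]; compute_degree!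

theorem monic_cubic (a t : ℤ) : (cubic a t).Monic := by
  rw [cubic_eq]; monicity!

/-- The only candidates for rational roots are `±1`. -/
theorem irreducible_cubic {a t : ℤ} (ha : 1 ≤ a) (hS : a ^ 2 < a ^ 4 - a + t) :
    Irreducible ((cubic a t).map (Int.castRingHom ℚ)) := by
  have hm := monic_cubic a t
  refine (hm.irreducible_iff_irreducible_map_fraction_map (K := ℚ)).mp ?_
  rw [hm.irreducible_iff_roots_eq_zero_of_degree_le_three (by rw [natDegree_cubic]; norm_num)
    (natDegree_cubic a t).le, Multiset.eq_zero_iff_forall_notMem]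
  intro x hx
  have h0 : x ^ 3 + (a * (a ^ 4 - a + t) - a ^ 2) * x ^ 2 + -(a ^ 4 - a + t) * x + 1 = 0 := by
    have := (mem_roots'.mp hx).2
    rw [cubic_eq, IsRoot] at this
    simpa only [eval_add, eval_mul, eval_pow, eval_X, eval_C] using this
  generalize a ^ 4 - a + t = S at h0 hS
  have hu : IsUnit x :=
    IsUnit.of_mul_eq_one (-(x ^ 2 + (a * S - a ^ 2) * x - S)) (by linear_combination -h0)
  rcases Int.isUnit_iff.mp hu with rfl | rfl
  · rcases ha.eq_or_lt with rfl | ha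
    · norm_num at h0
    · nlinarith
  · nlinarith

/-! ### Location of the roots -/

theorem exists_root_between {g : ℝ → ℝ} (hg : Continuous g) {x y : ℝ} (hxy : x ≤ y)
    (h : g x * g y < 0) : ∃ z, x < z ∧ z < y ∧ g z = 0 := by
  rcases mul_neg_iff.mp h with ⟨hx, hy⟩ | ⟨hx, hy⟩
  · obtain ⟨z, hz, hz0⟩ := intermediate_value_Ioo' hxy hg.continuousOn ⟨hy, hx⟩
    exact ⟨z, hz.1, hz.2, hz0⟩
  · obtain ⟨z, hz, hz0⟩ := intermediate_value_Ioo hxy hg.continuousOn ⟨hx, hy⟩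
    exact ⟨z, hz.1, hz.2, hz0⟩

/-- The approximate location of the three roots of `X³ - a²X² + SX(aX - 1) + 1`. -/
structure RootBounds (a S r₁ r₂ r₃ : ℝ) : Prop where
  r₁_gt : 1 / (2 * S) < r₁
  r₁_lt : r₁ < 2 / S
  r₂_gt : 1 / (2 * a) < r₂
  r₂_lt : r₂ < 1 / a
  r₃_gt : -(2 * (a * S)) < r₃
  r₃_lt : r₃ < -(a * S / 2)

theorem exists_roots {a S : ℝ} (ha : 1 ≤ a) (hS : 2 ^ 23 * a ^ 4 ≤ S) :
    ∃ r₁ r₂ r₃ : ℝ, RootBounds a S r₁ r₂ r₃ ∧ ∀ r, r = r₁ ∨ r = r₂ ∨ r = r₃ →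
      r ^ 3 - a ^ 2 * r ^ 2 + S * r * (a * r - 1) + 1 = 0 := by
  set g : ℝ → ℝ := fun r => r ^ 3 - a ^ 2 * r ^ 2 + S * r * (a * r - 1) + 1 with hg
  have hgc : Continuous g := by fun_prop
  have ha0 : 0 < a := by linarith
  have ha2 : a ≤ a ^ 2 := by nlinarith
  have ha4 : a ^ 2 ≤ a ^ 4 := by nlinarith [sq_nonneg (a ^ 2)]
  have hS0 : 0 < S := by nlinarith
  have hSa : 8 * a ≤ S := by linarith
  have hSa2 : 8 * a ^ 2 ≤ S := by linarith
  have hS1 : 8 ≤ S := by linarith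
  have haS : a / S ≤ 1 / 8 := by rw [div_le_div_iff₀ hS0 (by norm_num)]; linarith
  have hi1 : 1 / S ≤ 1 / 8 := by gcongr
  have hi0 : 0 < 1 / S := by positivity
  have hai : a * (1 / S) ≤ 1 / 8 := by rw [mul_one_div]; exact haS
  have hSi : S * (1 / S) = 1 := by field_simp
  have hai0 : 0 < a * (1 / S) := by positivity
  -- values at the endpoints `s / 2` and `2 * s` of an interval around `s = 1 / S`
  set s := 1 / S with hs
  have g1 : 0 < g (s / 2) := by
    have : g (s / 2) = s ^ 3 / 8 - (a * s) ^ 2 / 4 + (S * s) / 2 * (a * s / 2 - 1) + 1 := by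
      simp only [hg]; ring
    rw [this, hSi]
    nlinarith [pow_pos hi0 3]
  have g2 : g (2 * s) < 0 := by
    have : g (2 * s) = 8 * (s * s ^ 2) - 4 * (a * s) ^ 2 + 2 * (S * s) * (2 * (a * s) - 1) + 1 := by
      simp only [hg]; ring
    rw [this, hSi]
    nlinarith [mul_pos hi0 hi0, mul_le_mul hi1 hi1 hi0.le (by norm_num)]
  -- values at the endpoints `b / 2` and `b` of an interval below `b = 1 / a`
  set b := 1 / a with hb
  have hab : a * b = 1 := by rw [hb]; field_simp
  have hb0 : 0 < b := by positivity
  have hb1 : b ≤ 1 := by rw [hb, div_le_one ha0]; exact ha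
  have hSb : 8 ≤ S * b := by rw [hb, mul_one_div, le_div_iff₀ ha0]; exact hSa
  have g3 : g (b / 2) < 0 := by
    have : g (b / 2) = b * b ^ 2 / 8 - (a * b) ^ 2 / 4 + (S * b) / 2 * (a * b / 2 - 1) + 1 := by
      simp only [hg]; ring
    rw [this, hab]
    nlinarith [mul_pos hb0 hb0, pow_le_one₀ hb0.le hb1 (n := 3)]
  have g4 : 0 < g b := by
    have : g b = b ^ 3 - (a * b) ^ 2 + S * b * (a * b - 1) + 1 := by
      simp only [hg]; ring
    rw [this, hab]
    nlinarith [pow_pos hb0 3]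
  have haS0 : 0 < a * S := by positivity
  have haS1 : 8 * a ^ 2 ≤ a * S := by nlinarith
  have haS2 : S ≤ a * S := by nlinarith
  have g5 : 0 < g (-(a * S / 2)) := by
    have : g (-(a * S / 2)) = (a * S) ^ 2 / 4 * (a * S / 2 - a ^ 2) + S * (a * S) / 2 + 1 := by
      simp only [hg]; ring
    rw [this]
    have : 0 < a * S / 2 - a ^ 2 := by linarith [pow_pos ha0 2]
    positivity
  have g6 : g (-(2 * (a * S))) < 0 := by
    have : g (-(2 * (a * S))) = (a * S) * (-4 * (a * S) ^ 2 - 4 * (a * S) * a ^ 2 + 2 * S) + 1 := by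
      simp only [hg]; ring
    rw [this]
    have h1 : -4 * (a * S) ^ 2 - 4 * (a * S) * a ^ 2 + 2 * S ≤ -1 := by
      have := mul_pos haS0 (pow_pos ha0 2)
      have : 8 * (a * S) ≤ (a * S) ^ 2 := by
        rw [sq]; exact mul_le_mul_of_nonneg_right (by linarith) haS0.le
      linarith
    have := mul_le_mul_of_nonneg_left h1 haS0.le
    linarith
  have hsb : 2 * s ≤ b / 2 := by
    rw [hs, hb]
    have : 1 / S ≤ 1 / (8 * a) := by gcongr
    have h2 : 1 / (8 * a) = 1 / a / 8 := by field_simp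
    have h3 : 0 < 1 / a := by positivity
    linarith
  obtain ⟨r₁, h1, h1', e1⟩ := exists_root_between hgc (by linarith) (mul_neg_of_pos_of_neg g1 g2)
  obtain ⟨r₂, h2, h2', e2⟩ := exists_root_between hgc (by linarith) (mul_neg_of_neg_of_pos g3 g4)
  obtain ⟨r₃, h3, h3', e3⟩ := exists_root_between hgc (by linarith) (mul_neg_of_neg_of_pos g6 g5)
  refine ⟨r₁, r₂, r₃, ⟨?_, ?_, ?_, h2', h3, h3'⟩, ?_⟩
  · calc 1 / (2 * S) = s / 2 := by rw [hs]; field_simp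
      _ < r₁ := h1
  · calc r₁ < 2 * s := h1'
      _ = 2 / S := by rw [hs]; ring
  · calc 1 / (2 * a) = b / 2 := by rw [hb]; field_simp
      _ < r₂ := h2
  · rintro r (rfl | rfl | rfl) <;> assumption

theorem vieta_of_distinct_roots {r₁ r₂ r₃ b c d : ℝ} (h12 : r₁ ≠ r₂) (h13 : r₁ ≠ r₃)
    (h23 : r₂ ≠ r₃) (h₁ : r₁ ^ 3 + b * r₁ ^ 2 + c * r₁ + d = 0)
    (h₂ : r₂ ^ 3 + b * r₂ ^ 2 + c * r₂ + d = 0) (h₃ : r₃ ^ 3 + b * r₃ ^ 2 + c * r₃ + d = 0) :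
    r₁ + r₂ + r₃ = -b ∧ r₁ * r₂ + r₁ * r₃ + r₂ * r₃ = c ∧ r₁ * r₂ * r₃ = -d := by
  have e12 : r₁ ^ 2 + r₁ * r₂ + r₂ ^ 2 + b * (r₁ + r₂) + c = 0 :=
    mul_left_cancel₀ (sub_ne_zero.mpr h12) (by linear_combination h₁ - h₂)
  have e13 : r₁ ^ 2 + r₁ * r₃ + r₃ ^ 2 + b * (r₁ + r₃) + c = 0 :=
    mul_left_cancel₀ (sub_ne_zero.mpr h13) (by linear_combination h₁ - h₃)
  have hb : r₁ + r₂ + r₃ = -b :=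
    mul_left_cancel₀ (sub_ne_zero.mpr h23) (by linear_combination e12 - e13)
  have hb' : b = -(r₁ + r₂ + r₃) := by linarith
  have hc : r₁ * r₂ + r₁ * r₃ + r₂ * r₃ = c := by rw [hb'] at e12; linear_combination -e12
  refine ⟨hb, hc, ?_⟩
  rw [hb', ← hc] at h₁
  linear_combination h₁

/-- Sizes of the conjugates of `a * θ - 1`. The second uses that `a * r₂` is extremely close to `1`,
by the identity `(1 - a * r₂) * (S * r₂ - 1 - a * r₂) = r₂ ^ 3`. -/
theorem unit_bounds {a S r₁ r₂ r₃ : ℝ} (ha : 1 ≤ a) (hS : 2 ^ 23 * a ^ 4 ≤ S)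
    (h : RootBounds a S r₁ r₂ r₃)
    (h₂ : r₂ ^ 3 - a ^ 2 * r₂ ^ 2 + S * r₂ * (a * r₂ - 1) + 1 = 0) :
    (1 / 4 ≤ |a * r₁ - 1| ∧ |a * r₁ - 1| ≤ 4) ∧
    (1 / (4 * (a ^ 2 * S)) ≤ |a * r₂ - 1| ∧ |a * r₂ - 1| ≤ 4 / (a ^ 2 * S)) ∧
    (a ^ 2 * S / 4 ≤ |a * r₃ - 1| ∧ |a * r₃ - 1| ≤ 4 * (a ^ 2 * S)) := by
  have ha0 : 0 < a := by linarith
  have ha2 : a ≤ a ^ 2 := by nlinarith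
  have ha4 : a ^ 2 ≤ a ^ 4 := by nlinarith [sq_nonneg (a ^ 2)]
  have hS0 : 0 < S := by nlinarith
  have hSa : 16 * a ≤ S := by linarith
  have haS : 0 < a ^ 2 * S := by positivity
  refine ⟨?_, ?_, ?_⟩
  · have h1 : 0 < r₁ := lt_trans (by positivity) h.r₁_gt
    have h2 : a * r₁ ≤ 1 / 2 := by
      have := mul_lt_mul_of_pos_right h.r₁_lt hS0
      rw [div_mul_cancel₀ _ hS0.ne'] at this
      nlinarith
    rw [abs_of_neg (by linarith)]
    have : 0 < a * r₁ := by positivity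
    constructor <;> linarith
  · have h1 : 0 < r₂ := lt_trans (by positivity) h.r₂_gt
    have hx1 : a * r₂ < 1 := by
      have := mul_lt_mul_of_pos_left h.r₂_lt ha0
      rwa [mul_one_div_cancel ha0.ne'] at this
    have hx2 : 1 / 2 < a * r₂ := by
      have := mul_lt_mul_of_pos_left h.r₂_gt ha0
      have e : a * (1 / (2 * a)) = 1 / 2 := by field_simp
      rwa [e] at this
    have hfac : (1 - a * r₂) * (S * r₂ - 1 - a * r₂) = r₂ ^ 3 := by linear_combination -h₂
    have hSr : 8 < S * r₂ := by
      have : 16 * a * r₂ ≤ S * r₂ := by gcongr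
      linarith
    rw [abs_of_neg (by linarith), neg_sub]
    constructor
    · rw [div_le_iff₀ (by positivity)]
      have h3 : r₂ ^ 3 ≤ (1 - a * r₂) * (S * r₂) := by
        rw [← hfac]; gcongr; linarith
      have h4 : r₂ ^ 2 ≤ (1 - a * r₂) * S := by
        refine le_of_mul_le_mul_right ?_ h1
        linarith
      have h5 : a ^ 2 * r₂ ^ 2 ≤ a ^ 2 * ((1 - a * r₂) * S) := by gcongr
      nlinarith
    · rw [le_div_iff₀ (by positivity)]
      have h3 : (1 - a * r₂) * (S * r₂ / 2) ≤ r₂ ^ 3 := by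
        rw [← hfac]; gcongr; linarith
      have h4 : (1 - a * r₂) * S ≤ 2 * r₂ ^ 2 := by
        refine le_of_mul_le_mul_right ?_ h1
        linarith
      have h5 : a ^ 2 * ((1 - a * r₂) * S) ≤ a ^ 2 * (2 * r₂ ^ 2) := by gcongr
      nlinarith
  · have h3 : a * r₃ < -(a ^ 2 * S / 2) := by
      have := mul_lt_mul_of_pos_left h.r₃_lt ha0
      linarith
    have h4 : -(2 * (a ^ 2 * S)) < a * r₃ := by
      have := mul_lt_mul_of_pos_left h.r₃_gt ha0
      linarith
    have h5 : 1 ≤ a ^ 2 * S := by nlinarith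
    rw [abs_of_neg (by linarith)]
    constructor <;> linarith

theorem disc_bound {a S r₁ r₂ r₃ : ℝ} (ha : 1 ≤ a) (hS : 2 ^ 23 * a ^ 4 ≤ S)
    (h : RootBounds a S r₁ r₂ r₃) :
    a * S ^ 2 / 16 < |(r₁ - r₂) * (r₁ - r₃) * (r₂ - r₃)| := by
  have ha0 : 0 < a := by linarith
  have ha2 : a ≤ a ^ 2 := by nlinarith
  have ha4 : a ^ 2 ≤ a ^ 4 := by nlinarith [sq_nonneg (a ^ 2)]
  have hS0 : 0 < S := by nlinarith
  have hSa : 8 * a ≤ S := by linarith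
  have h1 : 1 / (4 * a) < r₂ - r₁ := by
    have h2 : 2 / S ≤ 2 / (8 * a) := by gcongr
    have e : 1 / (2 * a) - 2 / (8 * a) = 1 / (4 * a) := by field_simp; norm_num
    linarith [h.r₁_lt, h.r₂_gt]
  have p1 : 0 < r₁ := lt_trans (by positivity) h.r₁_gt
  have p2 : 0 < r₂ := lt_trans (by positivity) h.r₂_gt
  have h2 : a * S / 2 < r₁ - r₃ := by linarith [h.r₃_lt]
  have h3 : a * S / 2 < r₂ - r₃ := by linarith [h.r₃_lt]
  have p3 : 0 < a * S / 2 := by positivity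
  have p4 : 0 < 1 / (4 * a) := by positivity
  rw [abs_mul, abs_mul, abs_sub_comm r₁ r₂, abs_of_pos (p4.trans h1), abs_of_pos (p3.trans h2),
    abs_of_pos (p3.trans h3)]
  calc a * S ^ 2 / 16 = 1 / (4 * a) * (a * S / 2) * (a * S / 2) := by field_simp; norm_num
    _ < _ := by gcongr

/-! ### Logarithmic bounds -/

theorem RootBounds.order {a S r₁ r₂ r₃ : ℝ} (ha : 1 ≤ a) (hS : 2 ^ 23 * a ^ 4 ≤ S)
    (h : RootBounds a S r₁ r₂ r₃) : 0 < r₁ ∧ r₁ < r₂ ∧ r₃ < 0 := by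
  have ha0 : 0 < a := by linarith
  have ha4 : a ≤ a ^ 4 := le_self_pow₀ ha (by norm_num)
  have hS0 : 0 < S := lt_of_lt_of_le (by positivity) hS
  refine ⟨lt_trans (by positivity) h.r₁_gt, ?_, h.r₃_lt.trans (by linarith [mul_pos ha0 hS0])⟩
  refine h.r₁_lt.trans_le (le_trans ?_ h.r₂_gt.le)
  rw [div_le_div_iff₀ hS0 (by positivity)]
  linarith

theorem abs_log_sub_log_le {x y : ℝ} (hy : 0 < y) (h₁ : y / 4 ≤ x) (h₂ : x ≤ 4 * y) :
    |Real.log x - Real.log y| ≤ 2 * Real.log 2 := by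
  have hlog4 : Real.log 4 = 2 * Real.log 2 := by
    rw [show (4 : ℝ) = 2 ^ 2 by norm_num, Real.log_pow]; norm_num
  have h3 := Real.log_le_log (by positivity) h₁
  have h4 := Real.log_le_log (lt_of_lt_of_le (by positivity) h₁) h₂
  rw [Real.log_div hy.ne' (by norm_num), hlog4] at h3
  rw [Real.log_mul (by norm_num) hy.ne', hlog4] at h4
  rw [abs_le]
  constructor <;> linarith

theorem log_root_bounds {a S r₁ r₂ r₃ : ℝ} (ha : 1 ≤ a) (hS : 2 ^ 23 * a ^ 4 ≤ S)
    (h : RootBounds a S r₁ r₂ r₃) :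
    |Real.log |r₁| + Real.log S| ≤ 2 * Real.log 2 ∧
    |Real.log |r₂| + Real.log a| ≤ 2 * Real.log 2 ∧
    |Real.log |r₃| - (Real.log a + Real.log S)| ≤ 2 * Real.log 2 := by
  have ha0 : 0 < a := by linarith
  have hS0 : 0 < S := lt_of_lt_of_le (by positivity) hS
  have haS := mul_pos ha0 hS0
  obtain ⟨h1, h2, h3⟩ := h.order ha hS
  refine ⟨?_, ?_, ?_⟩
  · rw [abs_of_pos h1, ← sub_neg_eq_add, ← Real.log_inv]
    have e : 1 / (2 * S) = S⁻¹ / 2 := by field_simp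
    have e' : 2 / S = 2 * S⁻¹ := by field_simp
    have := inv_pos.mpr hS0
    exact abs_log_sub_log_le this (by linarith [h.r₁_gt]) (by linarith [h.r₁_lt])
  · rw [abs_of_pos (h1.trans h2), ← sub_neg_eq_add, ← Real.log_inv]
    have e : 1 / (2 * a) = a⁻¹ / 2 := by field_simp
    have e' : 1 / a = a⁻¹ := by field_simp
    have := inv_pos.mpr ha0
    exact abs_log_sub_log_le this (by linarith [h.r₂_gt]) (by linarith [h.r₂_lt])
  · rw [abs_of_neg h3, ← Real.log_mul ha0.ne' hS0.ne']
    exact abs_log_sub_log_le haS (by linarith [h.r₃_lt]) (by linarith [h.r₃_gt])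

theorem log_unit_bounds {a S r₁ r₂ r₃ : ℝ} (ha : 1 ≤ a) (hS : 2 ^ 23 * a ^ 4 ≤ S)
    (h : RootBounds a S r₁ r₂ r₃)
    (h₂ : r₂ ^ 3 - a ^ 2 * r₂ ^ 2 + S * r₂ * (a * r₂ - 1) + 1 = 0) :
    |(Real.log |a * r₁ - 1|)| ≤ 2 * Real.log 2 ∧
    |Real.log |a * r₂ - 1| + (2 * Real.log a + Real.log S)| ≤ 2 * Real.log 2 ∧
    |Real.log |a * r₃ - 1| - (2 * Real.log a + Real.log S)| ≤ 2 * Real.log 2 := by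
  have ha0 : 0 < a := by linarith
  have hS0 : 0 < S := lt_of_lt_of_le (by positivity) hS
  have haS : 0 < a ^ 2 * S := by positivity
  have e : 2 * Real.log a + Real.log S = Real.log (a ^ 2 * S) := by
    rw [Real.log_mul (by positivity) hS0.ne', Real.log_pow]; norm_num
  obtain ⟨⟨b1, b1'⟩, ⟨b2, b2'⟩, ⟨b3, b3'⟩⟩ := unit_bounds ha hS h h₂
  rw [e]
  refine ⟨?_, ?_, abs_log_sub_log_le haS b3 b3'⟩
  · have := abs_log_sub_log_le one_pos b1 (by linarith)
    rwa [Real.log_one, sub_zero] at this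
  · rw [← sub_neg_eq_add, ← Real.log_inv]
    have e1 : 1 / (4 * (a ^ 2 * S)) = (a ^ 2 * S)⁻¹ / 4 := by field_simp
    exact abs_log_sub_log_le (inv_pos.mpr haS) (e1 ▸ b2) (by rwa [← div_eq_mul_inv])

/-! ### Fundamental units for large parameters -/

theorem exists_cubic_factorization {a t : ℤ} (ha : 1 ≤ a)
    (hS : 2 ^ 23 * (a : ℝ) ^ 4 ≤ a ^ 4 - a + t) :
    ∃ r₁ r₂ r₃ : ℝ, RootBounds a (a ^ 4 - a + t) r₁ r₂ r₃ ∧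
      (r₁ + r₂ + r₃ = -((a * (a ^ 4 - a + t) - a ^ 2 : ℤ) : ℝ) ∧
        r₁ * r₂ + r₁ * r₃ + r₂ * r₃ = ((-(a ^ 4 - a + t) : ℤ) : ℝ) ∧
        r₁ * r₂ * r₃ = -((1 : ℤ) : ℝ)) ∧
      (cubic a t).map (Int.castRingHom ℝ) = (X - C r₁) * (X - C r₂) * (X - C r₃) := by
  have haR : (1 : ℝ) ≤ a := by exact_mod_cast ha
  obtain ⟨r₁, r₂, r₃, hr, hroot⟩ := exists_roots haR hS
  obtain ⟨h1, h12, h3⟩ := hr.order haR hS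
  have hcoeff : ∀ r, r = r₁ ∨ r = r₂ ∨ r = r₃ →
      r ^ 3 + ((a * (a ^ 4 - a + t) - a ^ 2 : ℤ) : ℝ) * r ^ 2 +
        ((-(a ^ 4 - a + t) : ℤ) : ℝ) * r + ((1 : ℤ) : ℝ) = 0 := by
    intro r h
    push_cast
    linear_combination hroot r h
  have hv := vieta_of_distinct_roots h12.ne (h3.trans h1).ne' (h3.trans (h1.trans h12)).ne'
    (hcoeff r₁ (.inl rfl)) (hcoeff r₂ (.inr (.inl rfl))) (hcoeff r₃ (.inr (.inr rfl)))
  refine ⟨r₁, r₂, r₃, hr, hv, ?_⟩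
  have : (X - C r₁) * (X - C r₂) * (X - C r₃) = X ^ 3 - C (r₁ + r₂ + r₃) * X ^ 2
      + C (r₁ * r₂ + r₁ * r₃ + r₂ * r₃) * X - C (r₁ * r₂ * r₃) := by
    simp only [map_add, map_mul]; ring
  rw [this, hv.1, hv.2.1, hv.2.2, cubic_eq]
  simp only [Polynomial.map_add, Polynomial.map_mul, Polynomial.map_pow, map_X, map_C, map_neg,
    Polynomial.map_neg, Int.coe_castRingHom, Int.cast_neg]
  ring

theorem exists_units {a t : ℤ} {θ : ℝ} (hθ : aeval θ (cubic a t) = 0) :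
    ∃ u v : (Algebra.adjoin ℤ {θ}).toSubringˣ,
      ((u : (Algebra.adjoin ℤ {θ}).toSubring) : ℝ) = θ ∧
      ((v : (Algebra.adjoin ℤ {θ}).toSubring) : ℝ) = a * θ - 1 := by
  let x : (Algebra.adjoin ℤ {θ}).toSubring := ⟨θ, Algebra.self_mem_adjoin_singleton ℤ θ⟩
  have hx : x ^ 3 - a ^ 2 * x ^ 2 + (a ^ 4 - a + t) * x * (a * x - 1) + 1 = 0 := by
    apply Subtype.ext
    rw [aeval_cubic] at hθ
    simpa [x] using hθ
  set y := -(x ^ 2 - a ^ 2 * x + (a ^ 4 - a + t) * (a * x - 1)) with hy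
  have hxy : x * y = 1 := by rw [hy]; linear_combination -hx
  -- `(aθ - 1)(Sθ - 1 - aθ) = -θ³` is a unit
  have hz : (a * x - 1) * (((a ^ 4 - a + t) * x - 1 - a * x) * -y ^ 3) = 1 := by
    have e : (a * x - 1) * ((a ^ 4 - a + t) * x - 1 - a * x) = -x ^ 3 := by linear_combination hx
    calc _ = ((a * x - 1) * ((a ^ 4 - a + t) * x - 1 - a * x)) * -y ^ 3 := by ring
      _ = (x * y) ^ 3 := by rw [e]; ring
      _ = 1 := by rw [hxy, one_pow]
  refine ⟨Units.mkOfMulEqOne _ _ hxy, Units.mkOfMulEqOne _ _ hz, rfl, ?_⟩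
  simp [x]

theorem isFundamentalUnits_of_large {a t : ℤ} (ha : 1 ≤ a)
    (hS : 2 ^ 23 * (a : ℝ) ^ 4 ≤ a ^ 4 - a + t) :
    Irreducible ((cubic a t).map (Int.castRingHom ℚ)) ∧
      ((cubic a t).map (Int.castRingHom ℝ)).Splits ∧
      ∃ θ : ℝ, IsSmallestPosRoot a t θ ∧
        IsFundamentalUnits (Algebra.adjoin ℤ {θ}).toSubring θ ((a : ℝ) * θ - 1) := by
  have haR : (1 : ℝ) ≤ a := by exact_mod_cast ha
  have hm := monic_cubic a t
  have hdeg := natDegree_cubic a t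
  have hirr : Irreducible ((cubic a t).map (Int.castRingHom ℚ)) := by
    refine irreducible_cubic ha ?_
    have : (a : ℝ) ^ 2 < a ^ 4 - a + t := by
      have : (a : ℝ) ^ 2 ≤ a ^ 4 := pow_le_pow_right₀ haR (by norm_num)
      have : (0 : ℝ) < a ^ 2 := by positivity
      linarith
    exact_mod_cast this
  obtain ⟨r₁, r₂, r₃, hr, ⟨hb, hc, hd⟩, hfac⟩ := exists_cubic_factorization ha hS
  obtain ⟨h1, h12, h3⟩ := hr.order haR hS
  have hroots : ∀ x : ℝ, aeval x (cubic a t) = (x - r₁) * (x - r₂) * (x - r₃) := by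
    intro x
    have h := congrArg (eval x) hfac
    rw [eval_map, ← algebraMap_int_eq, ← aeval_def] at h
    simpa using h
  refine ⟨hirr, ?_, r₁, ⟨⟨h1, by rw [hroots]; ring⟩, ?_⟩, ?_⟩
  · rw [hfac]
    exact ((Splits.X_sub_C _).mul (Splits.X_sub_C _)).mul (Splits.X_sub_C _)
  · rintro x ⟨hx, hx0⟩
    rw [hroots, mul_eq_zero, mul_eq_zero] at hx0
    rcases hx0 with (h | h) | h <;> linarith
  have z1 : aeval r₁ (cubic a t) = 0 := by rw [hroots]; ring
  have z2 : aeval r₂ (cubic a t) = 0 := by rw [hroots]; ring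
  have z3 : aeval r₃ (cubic a t) = 0 := by rw [hroots]; ring
  obtain ⟨u, v, hu, hv⟩ := exists_units z1
  obtain ⟨σ₁, hσ₁⟩ := exists_conj hm hirr z1 z1
  obtain ⟨σ₂, hσ₂⟩ := exists_conj hm hirr z1 z2
  obtain ⟨σ₃, hσ₃⟩ := exists_conj hm hirr z1 z3
  have hσ : ∀ x, ∃ p q r : ℤ, σ₁ x = p + q * r₁ + r * r₁ ^ 2 ∧ σ₂ x = p + q * r₂ + r * r₂ ^ 2 ∧
      σ₃ x = p + q * r₃ + r * r₃ ^ 2 := by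
    intro x
    obtain ⟨p, q, r, h⟩ := exists_int_coords hm hdeg z1 x.2
    refine ⟨p, q, r, ?_, ?_, ?_⟩
    · rw [hσ₁ x _ h]; simp
    · rw [hσ₂ x _ h]; simp
    · rw [hσ₃ x _ h]; simp
  have hinj : Function.Injective σ₁ := by
    have hid : ∀ x, σ₁ x = x := by
      intro x
      obtain ⟨p, q, r, h⟩ := exists_int_coords hm hdeg z1 x.2
      rw [hσ₁ x _ h, h]
    intro x y hxy
    rw [hid, hid] at hxy
    exact Subtype.ext hxy
  have hlog : ∀ (σ : (Algebra.adjoin ℤ {r₁}).toSubring →+* ℝ) (r : ℝ),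
      (∀ (x : (Algebra.adjoin ℤ {r₁}).toSubring) (p : ℤ[X]), (x : ℝ) = aeval r₁ p →
        σ x = aeval r p) → logAbs σ (.ofMul u) = Real.log |r| ∧
      logAbs σ (.ofMul v) = Real.log |a * r - 1| := by
    intro σ r h
    rw [logAbs_ofMul, logAbs_ofMul, h _ X (by rw [hu, aeval_X]),
      h _ (C a * X - 1) (by rw [hv]; simp)]
    simp
  obtain ⟨u1, v1⟩ := hlog σ₁ r₁ hσ₁
  obtain ⟨u2, v2⟩ := hlog σ₂ r₂ hσ₂
  obtain ⟨u3, v3⟩ := hlog σ₃ r₃ hσ₃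
  obtain ⟨U1, U2, U3⟩ := log_root_bounds haR hS hr
  obtain ⟨V1, V2, V3⟩ := log_unit_bounds haR hS hr (by rw [← aeval_cubic, z2])
  rw [← u1, abs_le] at U1
  rw [← u2, abs_le] at U2
  rw [← u3, abs_le] at U3
  rw [← v1, abs_le] at V1
  rw [← v2, abs_le] at V2
  rw [← v3, abs_le] at V3
  have hDS := disc_bound haR hS hr
  have hS0 : (0 : ℝ) < a ^ 4 - a + t := lt_of_lt_of_le (by positivity) hS
  generalize (a ^ 4 - a + t : ℝ) = S at *
  have ha0 : (0 : ℝ) < a := by linarith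
  have hk : 0 < Real.log 2 := Real.log_pos (by norm_num)
  have hA : 0 ≤ Real.log a := Real.log_nonneg haR
  have hLA : 23 * Real.log 2 + 4 * Real.log a ≤ Real.log S := by
    have := Real.log_le_log (by positivity) hS
    rw [Real.log_mul (by positivity) (by positivity), Real.log_pow, Real.log_pow] at this
    exact_mod_cast this
  have hD : 8 * Real.exp (3 / 2 * Real.log S + 3 * Real.log a + 4 * Real.log 2) <
      |(r₁ - r₂) * (r₁ - r₃) * (r₂ - r₃)| := by
    refine lt_trans ?_ hDS
    rw [← Real.log_lt_log_iff (by positivity) (by positivity),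
      Real.log_mul (by norm_num) (Real.exp_pos _).ne', Real.log_exp,
      Real.log_div (by positivity) (by norm_num), Real.log_mul (by positivity) (by positivity),
      Real.log_pow, show (8 : ℝ) = 2 ^ 3 by norm_num, show (16 : ℝ) = 2 ^ 4 by norm_num,
      Real.log_pow, Real.log_pow]
    push_cast
    linarith
  have hsum : ∀ w, logAbs σ₁ w + logAbs σ₂ w + logAbs σ₃ w = 0 := by
    intro w
    have hne : ∀ σ : (Algebra.adjoin ℤ {r₁}).toSubring →+* ℝ, |σ (w.toMul : _ˣ)| ≠ 0 := fun σ =>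
      abs_ne_zero.mpr ((w.toMul.isUnit.map σ).ne_zero)
    have := congrArg Real.log (abs_norm_unit_eq_one hb hc hd hσ w.toMul)
    rw [Real.log_mul (mul_ne_zero (hne _) (hne _)) (hne _), Real.log_mul (hne _) (hne _),
      Real.log_one] at this
    exact this
  have habs : ∀ {x y z : ℝ}, x + y ≤ z → x - y ≤ z → -x + y ≤ z → -x - y ≤ z →
      |x| + |y| ≤ z := by
    intro x y z _ _ _ _
    rcases abs_cases x with ⟨h, _⟩ | ⟨h, _⟩ <;> rcases abs_cases y with ⟨h', _⟩ | ⟨h', _⟩ <;>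
      linarith
  -- the largest of the three bounds below is the one for the second and third embeddings
  rw [← hv]
  nth_rw 2 [← hu]
  refine isFundamentalUnits_of_reduction (logAbs σ₁) (logAbs σ₂) (logAbs σ₃) hsum u v ?_
    (3 / 2 * Real.log S + 3 * Real.log a + 4 * Real.log 2) ?_ ?_ ?_
    (unit_eq_one_or_neg_one hinj hb hc hd (irrational_of_irreducible hm hdeg hirr z1)
      (irrational_of_irreducible hm hdeg hirr z2) (irrational_of_irreducible hm hdeg hirr z3)
      hσ hD)
  · -- the diagonal entries of the determinant exceed `log S / 2`, the others do not
    refine ne_of_gt (sub_pos.mpr ?_)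
    generalize logAbs σ₁ (.ofMul u) = x₁ at *
    generalize logAbs σ₂ (.ofMul u) = x₂ at *
    generalize logAbs σ₁ (.ofMul v) = y₁ at *
    generalize logAbs σ₂ (.ofMul v) = y₂ at *
    have hx₁ : Real.log S / 2 < -x₁ := by linarith
    have hy₂ : Real.log S / 2 < -y₂ := by linarith
    have hx₂ : |x₂| ≤ Real.log S / 2 := abs_le.mpr ⟨by linarith, by linarith⟩
    have hy₁ : |y₁| ≤ Real.log S / 2 := abs_le.mpr ⟨by linarith, by linarith⟩
    have hL : 0 < Real.log S / 2 := by linarith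
    calc x₂ * y₁ ≤ |x₂| * |y₁| := (le_abs_self _).trans (abs_mul _ _).le
      _ ≤ Real.log S / 2 * (Real.log S / 2) := by gcongr
      _ < -x₁ * -y₂ := by gcongr
      _ = x₁ * y₂ := neg_mul_neg _ _
  all_goals
    exact habs (by linarith) (by linarith) (by linarith) (by linarith)

end CubicOrders

theorem mainTheorem2 (α : ℝ) (hα₀ : 0 < α) (hα₁ : α < 1 / 4) :
    ∃ T : ℕ, ∀ (c : ℝ) (a : ℕ → ℤ), 0 < c → c < 1 →
      (∀ t : ℕ, 1 ≤ t → c * (t : ℝ) ^ α ≤ (a t : ℝ) ∧ (a t : ℝ) ≤ (t : ℝ) ^ α) →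
      ∀ t : ℕ, T ≤ t →
        Irreducible ((CubicOrders.cubic (a t) t).map (Int.castRingHom ℚ)) ∧
        ((CubicOrders.cubic (a t) t).map (Int.castRingHom ℝ)).Splits ∧
        ∃ θ : ℝ, CubicOrders.IsSmallestPosRoot (a t) t θ ∧
          CubicOrders.IsFundamentalUnits (Algebra.adjoin ℤ {θ}).toSubring
            θ ((a t : ℝ) * θ - 1) := by
  have hα : 0 < 1 - 4 * α := by linarith
  obtain ⟨T, hT⟩ := Filter.eventually_atTop.mp
    (((tendsto_rpow_atTop hα).comp tendsto_natCast_atTop_atTop).eventually_ge_atTop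
      ((2 : ℝ) ^ 23))
  refine ⟨max T 1, fun c a hc _ hca t ht => ?_⟩
  have ht1 : 1 ≤ t := (le_max_right _ _).trans ht
  have ht0 : (0 : ℝ) < t := by exact_mod_cast ht1
  obtain ⟨hlo, hhi⟩ := hca t ht1
  have ha0 : (0 : ℝ) < a t := lt_of_lt_of_le (by positivity) hlo
  have ha : 1 ≤ a t := by exact_mod_cast ha0
  have haR : (1 : ℝ) ≤ a t := by exact_mod_cast ha
  refine CubicOrders.isFundamentalUnits_of_large ha ?_
  have h1 : (2 : ℝ) ^ 23 ≤ (t : ℝ) ^ (1 - 4 * α) := hT t ((le_max_left _ _).trans ht)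
  have h2 : (a t : ℝ) ^ 4 ≤ (t : ℝ) ^ (4 * α) := by
    calc (a t : ℝ) ^ 4 ≤ ((t : ℝ) ^ α) ^ 4 := by gcongr
      _ = (t : ℝ) ^ (4 * α) := by
        rw [← Real.rpow_natCast, ← Real.rpow_mul ht0.le]; norm_num [mul_comm]
  have h3 : (a t : ℝ) ≤ a t ^ 4 := le_self_pow₀ haR (by norm_num)
  -- `2 ^ 23 * a ^ 4 ≤ t ^ (1 - 4α) * t ^ (4α) = t ≤ S`
  calc (2 : ℝ) ^ 23 * (a t : ℝ) ^ 4 ≤ (t : ℝ) ^ (1 - 4 * α) * (t : ℝ) ^ (4 * α) := by gcongr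
    _ = t := by rw [← Real.rpow_add ht0]; simp
    _ ≤ (a t : ℝ) ^ 4 - a t + (t : ℤ) := by push_cast; linarith
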